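/- **Setting.** Let $\Xi\subseteq\mathbb R^m$ be a convex (Borel) set and let $Q=\sum_{i=1}^N p_i\delta_{\xi^i}$ with $\xi^i\in\Xi$, $p_i>0$, $\sum_i p_i=1$. For $\theta>0$ let $\mathcal B(Q,\theta)$ be the set of probability distributions $P$ on $\Xi$ with $d_W(P,Q)\le\theta$, where $d_W(P,Q)=\inf_\Pi\left(\mathbb E_{(\xi,\zeta)\sim\Pi}\|\xi-\zeta\|_2^2\right)^{1/2}$ over all couplings $\Pi$ of $P$ and $Q$. Let $\mathcal X\subseteq\mathbb R^d$ be compact and convex with $0\in\mathcal X$ and $\mathcal X\subseteq[0,b]=\prod_j[0,b_j]$ for some $b\in\mathbb R^d$. Consider $$\mathrm{OPT}=\sup_{x\in\mathcal X}F(x),\qquad F(x)=\inf_{P\in\mathcal B(Q,\theta)}\mathbb E_{\xi\sim P}[f(x,\xi)],\tag{DR-SFM}$$ for a function $f:\mathbb R^d\times\Xi\to\mathbb R$ that is nonnegative on $\mathcal X\times\Xi$, such that $f(x,\cdot)$ is convex and measurable on $\Xi$ for every $x\in\mathcal X$, and such that for every $\xi\in\Xi$ the function $g=f(\cdot,\xi)$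 is monotone ($x\le y\Rightarrow g(x)\le g(y)$) and DR-submodular on the box $[0,b]$, i.e. $g(y+\alpha e_j)-g(y)\le g(x+\alpha e_j)-g(x)$ whenever $x\le y$, $\alpha\ge0$ and $x,y,x+\alpha e_j,y+\alpha e_j\in[0,b]$. A point $\hat x$ is an $(\alpha,\epsilon)$-approximate solution of (DR-SFM) if $\hat x\in\mathcal X$ and $F(\hat x)\ge\alpha\,\mathrm{OPT}-\epsilon$. Let $Z=\{(\zeta^1,\dots,\zeta^N)\in\Xi^N:\sum_ip_i\|\xi^i-\zeta^i\|_2^2\le\theta^2\}$ and $\Gamma=\bigcup_i\{\zeta\in\Xi:p_i\|\xi^i-\zeta\|_2^2\le\theta^2\}$. Let $\|\cdot\|$ be a norm on $\mathbb R^d$ with dual norm $\|\cdot\|_*$, and assume: $f(x,\cdot)$ is bounded on $\Gamma$ for every $x\in\mathcal X$; for every $\xi\in\Gamma$, $f(\cdot,\xi)$ is differentiable at every point of $\mathcal X$ and $L_1$-Lipschitz on $\mathcal X$ with respect to $\|\cdot\|$; $\|\nabla_xf(x^1,\xi)-\nabla_xf(x^2,\xi)\|_*\le\lambda_1\|x^1-x^2\|$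 for $x^1,x^2\in\mathcal X$, $\xi\in\Gamma$; and $\|\nabla_xf(y,\xi^1)-\nabla_xf(y,\xi^2)\|_*\le\lambda_2\|\xi^1-\xi^2\|_2$ for $y\in\mathcal X$, $\xi^1,\xi^2\in\Gamma$. **Algorithm.** For $\epsilon>0$ put $$R(x,\zeta^1,\dots,\zeta^N)=\sum_{i}p_i\Big(f(x,\zeta^i)+\frac{\epsilon}{2\theta^2}\|\xi^i-\zeta^i\|_2^2\Big),\qquad H(x)=\inf_{\zeta\in Z}R(x,\zeta).$$ With inner accuracy $\Delta$ and $T\ge1$ iterations, the continuous greedy algorithm starts at $x_0=0$. For $t=1,\dots,T$ it takes any $\hat\zeta_t\in Z$ with $R(x_{t-1},\hat\zeta_t)-H(x_{t-1})\le\Delta$ and any $v_t\in\operatorname{argmax}_{v\in\mathcal X}\sum_ip_i\langle\nabla_xf(x_{t-1},\hat\zeta_t^i),v\rangle$, and sets $x_t=x_{t-1}+\frac1Tv_t$. It returns $x_T=\frac1T(v_1+\dots+v_T)$. **Theorem.** There are constants $c,C>0$, depending only on $L_1,\lambda_1,\lambda_2,\theta$ and an upper bound $\rho$ on $\|x\|$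 over $x\in\mathcal X$, such that for every $\epsilon>0$, every $\Delta\le c\,\epsilon^3$ and every integer $T\ge C/\epsilon^2$, every run of the algorithm with $T$ iterations returns a $(1-1/e,\epsilon)$-approximate solution of (DR-SFM). In particular $O(1/\epsilon^2)$ iterations suffice. -/

import Mathlib

open scoped ENNReal
open MeasureTheory

noncomputable section

namespace WassersteinDRO

/-! ### Order-theoretic and norm notions on `ℝ^d` -/

/-- Monotonicity on `S` for the componentwise order. -/
def MonoOn {d : ℕ} (S : Set (Fin d → ℝ)) (g : (Fin d → ℝ) → ℝ) : Prop :=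
  ∀ x ∈ S, ∀ y ∈ S, x ≤ y → g x ≤ g y

/-- DR-submodularity on `S` (diminishing returns): adding the same amount `α ≥ 0` of a coordinate
to a larger point gains no more than adding it to a smaller point. -/
def DRSubmodularOn {d : ℕ} (S : Set (Fin d → ℝ)) (g : (Fin d → ℝ) → ℝ) : Prop :=
  ∀ x ∈ S, ∀ y ∈ S, x ≤ y → ∀ (i : Fin d) (α : ℝ), 0 ≤ α →
    x + Pi.single i α ∈ S → y + Pi.single i α ∈ S →
      g (y + Pi.single i α) - g y ≤ g (x + Pi.single i α) - g x

/-- A norm on `ℝ^d`: a seminorm that separates points. -/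
def IsNorm {d : ℕ} (nrm : Seminorm ℝ (Fin d → ℝ)) : Prop :=
  ∀ x, nrm x = 0 → x = 0

/-- The dual norm of `nrm`, on linear functionals (gradients are regarded as linear functionals). -/
def dualNorm {d : ℕ} (nrm : Seminorm ℝ (Fin d → ℝ)) (g : (Fin d → ℝ) →L[ℝ] ℝ) : ℝ :=
  sSup {r : ℝ | ∃ v : Fin d → ℝ, nrm v ≤ 1 ∧ r = g v}

/-! ### Wasserstein distance -/

/-- `γ` is a coupling of `P` and `Q`. -/
def IsCoupling {m : ℕ}
    (γ : Measure (EuclideanSpace ℝ (Fin m) × EuclideanSpace ℝ (Fin m)))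
    (P Q : Measure (EuclideanSpace ℝ (Fin m))) : Prop :=
  γ.map Prod.fst = P ∧ γ.map Prod.snd = Q

/-- The 2-Wasserstein distance based on the `ℓ₂` norm, with values in `[0, ∞]`. -/
def wassersteinDist {m : ℕ} (P Q : Measure (EuclideanSpace ℝ (Fin m))) : ℝ≥0∞ :=
  ⨅ γ ∈ {γ : Measure (EuclideanSpace ℝ (Fin m) × EuclideanSpace ℝ (Fin m)) |
      IsCoupling γ P Q},
    (∫⁻ z, ‖z.1 - z.2‖ₑ ^ 2 ∂γ) ^ (1 / 2 : ℝ)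

/-! ### The distributionally robust problem -/

/-- The data of a Wasserstein distributionally robust maximization problem: the feasible region,
the sample space, the objective, the weights and atoms of the reference distribution, and the
radius of the ambiguity ball. -/
structure Problem (d m N : ℕ) where
  X : Set (Fin d → ℝ)
  Xi : Set (EuclideanSpace ℝ (Fin m))
  f : (Fin d → ℝ) → EuclideanSpace ℝ (Fin m) → ℝ
  p : Fin N → ℝ
  xi : Fin N → EuclideanSpace ℝ (Fin m)
  θ : ℝ

namespace Problem

variable {d m N : ℕ} (D : Problem d m N)

/-- The reference distribution `Q = ∑ i, p i • δ_{ξ i}`. -/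
def Q : Measure (EuclideanSpace ℝ (Fin m)) :=
  ∑ i, ENNReal.ofReal (D.p i) • Measure.dirac (D.xi i)

/-- The 2-Wasserstein ball of radius `θ` around `Q`, among probability distributions on `Ξ`. -/
def ball : Set (Measure (EuclideanSpace ℝ (Fin m))) :=
  {P | IsProbabilityMeasure P ∧ P D.Xiᶜ = 0 ∧ wassersteinDist P D.Q ≤ ENNReal.ofReal D.θ}

/-- The worst-case expectation `F x = inf_{P ∈ B(Q,θ)} E_{ξ ∼ P} [f x ξ]`. As `f` is nonnegative,
the expectation is well defined in `[0, ∞]`. -/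
def F (x : Fin d → ℝ) : ℝ≥0∞ :=
  ⨅ P ∈ D.ball, ∫⁻ ζ, ENNReal.ofReal (D.f x ζ) ∂P

/-- The optimal value `OPT = sup_{x ∈ X} F x`. -/
def opt : ℝ≥0∞ := ⨆ x ∈ D.X, D.F x

/-- `x` is an `(α, ε)`-approximate solution: `x` is feasible and `F x ≥ α * OPT - ε`. -/
def IsApproxSolution (α ε : ℝ) (x : Fin d → ℝ) : Prop :=
  x ∈ D.X ∧ ENNReal.ofReal α * D.opt ≤ D.F x + ENNReal.ofReal ε

/-- The set `Z` of admissible perturbed sample vectors. -/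
def Z : Set (Fin N → EuclideanSpace ℝ (Fin m)) :=
  {ζ | (∀ i, ζ i ∈ D.Xi) ∧ ∑ i, D.p i * ‖D.xi i - ζ i‖ ^ 2 ≤ D.θ ^ 2}

/-- The set `Γ` of single samples: the union over `i` of `{ζ ∈ Ξ | p i * ‖ξ i - ζ‖² ≤ θ²}`. -/
def Gam : Set (EuclideanSpace ℝ (Fin m)) :=
  {ζ | ζ ∈ D.Xi ∧ ∃ i, D.p i * ‖D.xi i - ζ‖ ^ 2 ≤ D.θ ^ 2}

/-- The regularized inner objective `R`. -/
def R (ε : ℝ) (x : Fin d → ℝ) (ζ : Fin N → EuclideanSpace ℝ (Fin m)) : ℝ :=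
  ∑ i, D.p i * (D.f x (ζ i) + ε / (2 * D.θ ^ 2) * ‖D.xi i - ζ i‖ ^ 2)

/-- The regularized surrogate `H x = inf_{ζ ∈ Z} R x ζ`. -/
def H (ε : ℝ) (x : Fin d → ℝ) : ℝ := ⨅ ζ : D.Z, D.R ε x ζ

/-- The gradient `∇ₓ f(x, ζ)`, as a linear functional on `ℝ^d`. -/
def grad (x : Fin d → ℝ) (ζ : EuclideanSpace ℝ (Fin m)) : (Fin d → ℝ) →L[ℝ] ℝ :=
  fderiv ℝ (fun y => D.f y ζ) x

/-- The standing assumptions: structure of the feasible region, of the reference distribution and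
of the objective, then boundedness on `Γ` and smoothness with constants `L₁`, `lam₁`, `lam₂` for the
norm `nrm` and its dual norm. The box `[0, b]` is a common domain, containing the feasible region,
on which `f(·, ξ)` is monotone and DR-submodular. -/
structure Assumptions (nrm : Seminorm ℝ (Fin d → ℝ)) (b : Fin d → ℝ) (L₁ lam₁ lam₂ : ℝ) :
    Prop where
  isNorm : IsNorm nrm
  X_compact : IsCompact D.X
  X_convex : Convex ℝ D.X
  zero_mem : (0 : Fin d → ℝ) ∈ D.X
  X_subset_box : D.X ⊆ Set.Icc 0 b
  Xi_measurable : MeasurableSet D.Xi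
  p_pos : ∀ i, 0 < D.p i
  p_sum : ∑ i, D.p i = 1
  xi_mem : ∀ i, D.xi i ∈ D.Xi
  θ_pos : 0 < D.θ
  f_nonneg : ∀ x ∈ D.X, ∀ ζ ∈ D.Xi, 0 ≤ D.f x ζ
  f_measurable : ∀ x ∈ D.X, Measurable (D.Xi.domRestrict (D.f x))
  f_convex : ∀ x ∈ D.X, ConvexOn ℝ D.Xi (D.f x)
  f_drSubmodular : ∀ ζ ∈ D.Xi, DRSubmodularOn (Set.Icc 0 b) (fun x => D.f x ζ)
  f_monotone : ∀ ζ ∈ D.Xi, MonoOn (Set.Icc 0 b) (fun x => D.f x ζ)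
  f_bounded : ∀ x ∈ D.X, ∃ B : ℝ, ∀ ζ ∈ D.Gam, |D.f x ζ| ≤ B
  f_differentiable : ∀ ζ ∈ D.Gam, ∀ x ∈ D.X, DifferentiableAt ℝ (fun y => D.f y ζ) x
  f_lipschitz : ∀ ζ ∈ D.Gam, ∀ x ∈ D.X, ∀ y ∈ D.X, |D.f x ζ - D.f y ζ| ≤ L₁ * nrm (x - y)
  grad_lipschitz_left : ∀ ζ ∈ D.Gam, ∀ x ∈ D.X, ∀ y ∈ D.X,
    dualNorm nrm (D.grad x ζ - D.grad y ζ) ≤ lam₁ * nrm (x - y)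
  grad_lipschitz_right : ∀ y ∈ D.X, ∀ ζ ∈ D.Gam, ∀ ζ' ∈ D.Gam,
    dualNorm nrm (D.grad y ζ - D.grad y ζ') ≤ lam₂ * ‖ζ - ζ'‖

/-- `x 0, …, x T` are the iterates of a `T`-iteration run of the continuous greedy algorithm with
regularization `ε` and inner accuracy `Δ`: starting from `0`, iteration `t + 1` takes any
`Δ`-approximate inner minimizer `ζ t ∈ Z` at the current point `x t`, any maximizer `v t` over `X` of
the linear functional `∑ i, p i • ∇ₓ f(x t, ζ t i)`, and moves by `(1 / T) • v t`. The point returned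
is `x T = (1 / T) • (v 0 + ⋯ + v (T - 1))`. -/
def IsRun (ε Δ : ℝ) (T : ℕ) (x : ℕ → Fin d → ℝ) : Prop :=
  x 0 = 0 ∧
  ∃ (ζ : ℕ → Fin N → EuclideanSpace ℝ (Fin m)) (v : ℕ → Fin d → ℝ), ∀ t < T,
    (ζ t ∈ D.Z ∧ D.R ε (x t) (ζ t) - D.H ε (x t) ≤ Δ) ∧
    (v t ∈ D.X ∧
      IsMaxOn (fun u => ∑ i, D.p i * D.grad (x t) (ζ t i) u) D.X (v t)) ∧
    x (t + 1) = x t + (1 / (T : ℝ)) • v t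

end Problem

end WassersteinDRO

end

/-! Conditioning a near-optimal coupling on the atoms of `Q`, and applying Jensen to each
conditional law, shows that `F x` is the infimum over `Z` of `∑ i, p i * f x (ζ i)` (`ofReal_le_F`,
`F_le_ofReal`). On `Z` the quadratic term of `R` lies between `0` and `ε / 2`, so `H` approximates
this infimum from above within `ε / 2`.

An infimum of DR-submodular functions is not DR-submodular, so continuous greedy must be justified
for `H` directly. The quadratic term makes `R` strongly convex in `ζ` with modulus of order `ε`;
hence near-minimizers at neighbouring iterates are close (`sum_norm_sub_le`), and a gradient
computed at one serves for the other. With `sub_le_fderiv_apply`, a step of length `1 / T` closes a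
fraction `1 / T` of the gap `G - H`, up to an error (`H_add_le_H_step`), and `(1 - 1 / T) ^ T ≤ exp
(-1)` gives the ratio.

Keeping near-minimizers within `r`, of order `ε`, requires inner accuracy of order `ε * r ^ 2` and
step length of order `ε * r`, whence the rates `ε ^ 3` and `1 / ε ^ 2`. -/

namespace WassersteinDRO

/-! ### Norms on a finite-dimensional space -/

/-- A linear functional on a finite-dimensional space is bounded with respect to any norm. -/
theorem exists_abs_le_mul_seminorm {E : Type*} [AddCommGroup E] [Module ℝ E]
    [FiniteDimensional ℝ E] (p : Seminorm ℝ E) (hp : ∀ x, p x = 0 → x = 0) (g : E →ₗ[ℝ] ℝ) :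
    ∃ C : ℝ, ∀ v, |g v| ≤ C * p v := by
  let _ : Norm E := ⟨p⟩
  have core : NormedSpace.Core ℝ E :=
    { norm_nonneg := fun x => apply_nonneg p x
      norm_smul := fun c x => map_smul_eq_mul p c x
      norm_triangle := fun x y => map_add_le_add p x y
      norm_eq_zero_iff := fun x => ⟨hp x, fun h => h ▸ map_zero p⟩ }
  let _ : NormedAddCommGroup E := NormedAddCommGroup.ofCore core
  let _ : NormedSpace ℝ E := NormedSpace.ofCore core
  exact ⟨‖LinearMap.toContinuousLinearMap g‖,
    fun v => (LinearMap.toContinuousLinearMap g).le_opNorm v⟩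

/-- `dualNorm` is a real `sSup`, informative only for a bounded set; finite dimension supplies the
bound. -/
theorem abs_apply_le_dualNorm_mul {d : ℕ} {nrm : Seminorm ℝ (Fin d → ℝ)} (hn : IsNorm nrm)
    (g : (Fin d → ℝ) →L[ℝ] ℝ) (v : Fin d → ℝ) : |g v| ≤ dualNorm nrm g * nrm v := by
  obtain ⟨C, hC⟩ := exists_abs_le_mul_seminorm nrm hn g.toLinearMap
  have hbdd : BddAbove {r : ℝ | ∃ v : Fin d → ℝ, nrm v ≤ 1 ∧ r = g v} := by
    refine ⟨|C|, ?_⟩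
    rintro _ ⟨u, hu, rfl⟩
    have h := (le_abs_self _).trans (hC u)
    exact h.trans ((mul_le_mul_of_nonneg_right (le_abs_self C) (apply_nonneg nrm u)).trans
      (mul_le_of_le_one_right (abs_nonneg C) hu))
  have key : ∀ u : Fin d → ℝ, g u ≤ dualNorm nrm g * nrm u := by
    intro u
    rcases eq_or_ne (nrm u) 0 with h0 | h0
    · simp [hn u h0]
    · have hpos : 0 < nrm u := lt_of_le_of_ne (apply_nonneg nrm u) (Ne.symm h0)
      have h : g ((nrm u)⁻¹ • u) ≤ dualNorm nrm g := by
        refine le_csSup hbdd ⟨_, ?_, rfl⟩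
        rw [map_smul_eq_mul, norm_inv, Real.norm_eq_abs, abs_of_pos hpos, inv_mul_cancel₀ h0]
      rw [map_smul, smul_eq_mul, inv_mul_le_iff₀ hpos] at h
      linarith
  refine abs_le'.2 ⟨key v, ?_⟩
  simpa using key (-v)

/-! ### Monotone DR-submodular functions -/

/-- Diminishing returns along an arbitrary nonnegative increment. -/
theorem DRSubmodularOn.add_sub_le {d : ℕ} {b : Fin d → ℝ} {g : (Fin d → ℝ) → ℝ}
    (hg : DRSubmodularOn (Set.Icc 0 b) g) {x y u : Fin d → ℝ} (hx : 0 ≤ x) (hxy : x ≤ y)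
    (hu : 0 ≤ u) (hyu : y + u ≤ b) : g (y + u) - g y ≤ g (x + u) - g x := by
  -- The coordinates of `u` are added one at a time; as `0 ≤ u`, all partial sums stay in the box.
  have key : ∀ s : Finset (Fin d),
      g (y + ∑ j ∈ s, Pi.single j (u j)) - g y ≤ g (x + ∑ j ∈ s, Pi.single j (u j)) - g x := by
    intro s
    induction s using Finset.induction_on with
    | empty => simp
    | insert j s hj ih =>
      have hnn : ∀ k ∈ (Finset.univ : Finset (Fin d)), (0 : Fin d → ℝ) ≤ Pi.single k (u k) :=
        fun k _ => Pi.single_nonneg.2 (hu k)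
      have h0 : ∀ t : Finset (Fin d), (0 : Fin d → ℝ) ≤ ∑ k ∈ t, Pi.single k (u k) :=
        fun t => Finset.sum_nonneg fun k _ => hnn k (Finset.mem_univ k)
      have h1 : ∀ t : Finset (Fin d), ∑ k ∈ t, Pi.single k (u k) ≤ u := fun t => by
        conv_rhs => rw [← Finset.univ_sum_single u]
        exact Finset.sum_le_sum_of_subset_of_nonneg (Finset.subset_univ t)
          fun k hk _ => hnn k hk
      have hmem : ∀ z : Fin d → ℝ, x ≤ z → z ≤ y → ∀ t : Finset (Fin d),
          z + ∑ k ∈ t, Pi.single k (u k) ∈ Set.Icc 0 b := fun z hxz hzy t =>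
        ⟨add_nonneg (hx.trans hxz) (h0 t), (add_le_add hzy (h1 t)).trans hyu⟩
      have e : ∀ z : Fin d → ℝ, z + ∑ k ∈ insert j s, Pi.single k (u k)
          = z + ∑ k ∈ s, Pi.single k (u k) + Pi.single j (u j) := fun z => by
        rw [Finset.sum_insert hj]; abel
      have hmx := hmem x le_rfl hxy
      have hmy := hmem y hxy le_rfl
      have h := hg _ (hmx s) _ (hmy s) (add_le_add_left hxy _) j (u j) (hu j)
        (e x ▸ hmx (insert j s)) (e y ▸ hmy (insert j s))
      rw [e, e]
      linarith
  simpa [Finset.univ_sum_single] using key Finset.univ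

/-- Steps `1 / (n + 1)` suit diminishing returns, since `w` then splits into `n + 1` equal pieces.
-/
theorem tendsto_slope_inv_nat {d : ℕ} {g : (Fin d → ℝ) → ℝ} {g' : (Fin d → ℝ) →L[ℝ] ℝ}
    {x : Fin d → ℝ} (hd : HasFDerivAt g g' x) (w : Fin d → ℝ) :
    Filter.Tendsto (fun n : ℕ => ((n : ℝ) + 1) * (g (x + (1 / ((n : ℝ) + 1)) • w) - g x))
      Filter.atTop (nhds (g' w)) := by
  have h2 : HasDerivAt (fun s : ℝ => x + s • w) w 0 := by
    simpa using ((hasDerivAt_id (0 : ℝ)).smul_const w).const_add x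
  have h1 : HasDerivAt (fun s : ℝ => g (x + s • w)) (g' w) 0 :=
    HasFDerivAt.comp_hasDerivAt (l := g) 0 (by simpa using hd) h2
  have h3 : Filter.Tendsto (fun n : ℕ => 1 / ((n : ℝ) + 1)) Filter.atTop
      (nhdsWithin 0 (Set.Ioi 0)) :=
    tendsto_nhdsWithin_iff.2 ⟨tendsto_one_div_add_atTop_nhds_zero_nat,
      Filter.Eventually.of_forall fun n => by simp only [Set.mem_Ioi]; positivity⟩
  refine (h1.tendsto_slope_zero_right.comp h3).congr fun n => ?_
  simp

/-- A DR-submodular function lies below its tangent along nonnegative directions. -/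
theorem DRSubmodularOn.sub_le_fderiv {d : ℕ} {b : Fin d → ℝ} {g : (Fin d → ℝ) → ℝ}
    (hg : DRSubmodularOn (Set.Icc 0 b) g) {x w : Fin d → ℝ} (hx : 0 ≤ x) (hw : 0 ≤ w)
    (hxw : x + w ≤ b) {g' : (Fin d → ℝ) →L[ℝ] ℝ} (hd : HasFDerivAt g g' x) :
    g (x + w) - g x ≤ g' w := by
  refine ge_of_tendsto' (tendsto_slope_inv_nat hd w) fun n => ?_
  set t : ℝ := 1 / ((n : ℝ) + 1) with ht
  have htpos : 0 ≤ t := by positivity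
  have htn : ((n + 1 : ℕ) : ℝ) * t = 1 := by rw [ht]; push_cast; field_simp
  -- Each of the `n + 1` pieces gains at most what the first one does.
  have key : ∀ k : ℕ, k ≤ n + 1 →
      g (x + ((k : ℝ) * t) • w) - g x ≤ k * (g (x + t • w) - g x) := by
    intro k hk
    induction k with
    | zero => simp
    | succ k ih =>
      have hkt : ((k + 1 : ℕ) : ℝ) * t ≤ 1 := by
        rw [← htn]; gcongr
      have e : x + (((k + 1 : ℕ) : ℝ) * t) • w = x + ((k : ℝ) * t) • w + t • w := by
        push_cast; module
      have h := hg.add_sub_le (x := x) (y := x + ((k : ℝ) * t) • w) (u := t • w) hx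
        (le_add_of_nonneg_right (smul_nonneg (by positivity) hw)) (smul_nonneg htpos hw)
        (by
          rw [← e]
          refine le_trans ?_ hxw
          have := smul_le_smul_of_nonneg_right hkt hw
          rw [one_smul] at this
          exact add_le_add_right this x)
      have := ih (by omega)
      rw [e]
      push_cast
      linarith
  have := key (n + 1) le_rfl
  rw [htn, one_smul] at this
  push_cast at this
  exact this

/-- The difference quotients run along `-u`: by `u ≤ x` they stay in the box, which steps along `u`
may leave. -/
theorem MonoOn.fderiv_nonneg {d : ℕ} {b : Fin d → ℝ} {g : (Fin d → ℝ) → ℝ}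
    (hg : MonoOn (Set.Icc 0 b) g) {x u : Fin d → ℝ} (hx : x ≤ b) (hu : 0 ≤ u)
    (hux : u ≤ x) {g' : (Fin d → ℝ) →L[ℝ] ℝ} (hd : HasFDerivAt g g' x) : 0 ≤ g' u := by
  have h : g' (-u) ≤ 0 := by
    refine le_of_tendsto' (tendsto_slope_inv_nat hd (-u)) fun n => ?_
    set t : ℝ := 1 / ((n : ℝ) + 1) with ht
    have htpos : 0 ≤ t := by positivity
    have ht1 : t ≤ 1 := by rw [ht, div_le_one (by positivity)]; linarith [n.cast_nonneg (α := ℝ)]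
    have h0 : 0 ≤ t • u := smul_nonneg htpos hu
    have h1 : t • u ≤ u := by simpa using smul_le_smul_of_nonneg_right ht1 hu
    have hle : x + t • (-u) ≤ x := by rw [smul_neg]; simpa using h0
    have hge : 0 ≤ x + t • (-u) := by
      rw [smul_neg, ← sub_eq_add_neg]; exact sub_nonneg.2 (h1.trans hux)
    have := hg _ ⟨hge, hle.trans hx⟩ x ⟨hu.trans hux, hx⟩ hle
    exact mul_nonpos_of_nonneg_of_nonpos (by positivity) (by linarith)
  simpa using h

/-- For a monotone DR-submodular function on a box, the gradient at `x` paired with any point `z` of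
the box bounds the possible gain `g z - g x`. -/
theorem sub_le_fderiv_apply {d : ℕ} {b : Fin d → ℝ} {g : (Fin d → ℝ) → ℝ}
    (hg : DRSubmodularOn (Set.Icc 0 b) g) (hm : MonoOn (Set.Icc 0 b) g) {x z : Fin d → ℝ}
    (hx : x ∈ Set.Icc 0 b) (hz : z ∈ Set.Icc 0 b) {g' : (Fin d → ℝ) →L[ℝ] ℝ}
    (hd : HasFDerivAt g g' x) : g z - g x ≤ g' z := by
  -- The splitting `z = (x ⊔ z - x) + x ⊓ z` leaves a nonnegative direction for the tangent bound
  -- and a remainder below `x`, where the derivative is nonnegative.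
  have h1 : g (x + (x ⊔ z - x)) - g x ≤ g' (x ⊔ z - x) :=
    hg.sub_le_fderiv hx.1 (sub_nonneg.2 le_sup_left)
      (by rw [add_sub_cancel]; exact sup_le hx.2 hz.2) hd
  have h2 : 0 ≤ g' (x ⊓ z) := hm.fderiv_nonneg hx.2 (le_inf hx.1 hz.1) inf_le_left hd
  have h3 : g z ≤ g (x ⊔ z) :=
    hm z hz _ ⟨hz.1.trans le_sup_right, sup_le hx.2 hz.2⟩ le_sup_right
  have e : z = x ⊔ z - x + x ⊓ z := by
    have := inf_add_sup x z
    rw [sub_add_eq_add_sub, add_comm (x ⊔ z), this, add_sub_cancel_left]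
  have h4 : g' z = g' (x ⊔ z - x) + g' (x ⊓ z) := by
    conv_lhs => rw [e]
    rw [map_add]
  rw [add_sub_cancel] at h1
  linarith

/-! ### Consequences of smoothness on the feasible region -/

namespace Problem.Assumptions

variable {d m N : ℕ} {D : Problem d m N} {nrm : Seminorm ℝ (Fin d → ℝ)} {b : Fin d → ℝ}
  {L₁ lam₁ lam₂ : ℝ}

theorem hasFDerivAt (h : D.Assumptions nrm b L₁ lam₁ lam₂) {ζ : EuclideanSpace ℝ (Fin m)}
    (hζ : ζ ∈ D.Gam) {x : Fin d → ℝ} (hx : x ∈ D.X) :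
    HasFDerivAt (fun y => D.f y ζ) (D.grad x ζ) x :=
  (h.f_differentiable ζ hζ x hx).hasFDerivAt

theorem grad_sub_mul_sq_le (h : D.Assumptions nrm b L₁ lam₁ lam₂)
    {ζ : EuclideanSpace ℝ (Fin m)} (hζ : ζ ∈ D.Gam) {x y : Fin d → ℝ} (hx : x ∈ D.X)
    (hy : y ∈ D.X) :
    D.grad x ζ (y - x) - |lam₁| * nrm (y - x) ^ 2 ≤ D.f y ζ - D.f x ζ := by
  obtain ⟨z, hz, hzeq⟩ := domain_mvt (f := fun y => D.f y ζ) (f' := fun x => D.grad x ζ)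
    (fun w hw => (h.hasFDerivAt hζ hw).hasFDerivWithinAt) h.X_convex hx hy
  have hzX : z ∈ D.X := h.X_convex.segment_subset hx hy hz
  have hnz : nrm (x - z) ≤ nrm (y - x) := by
    obtain ⟨s, ⟨hs0, hs1⟩, rfl⟩ := (segment_eq_image' ℝ x y) ▸ hz
    rw [show x - (x + s • (y - x)) = (-s) • (y - x) by module, map_smul_eq_mul]
    refine mul_le_of_le_one_left (apply_nonneg _ _) ?_
    rwa [norm_neg, Real.norm_eq_abs, abs_of_nonneg hs0]
  have h1 := abs_apply_le_dualNorm_mul h.isNorm (D.grad x ζ - D.grad z ζ) (y - x)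
  have h2 := h.grad_lipschitz_left ζ hζ x hx z hzX
  have h3 : lam₁ * nrm (x - z) ≤ |lam₁| * nrm (y - x) :=
    mul_le_mul (le_abs_self _) hnz (apply_nonneg _ _) (abs_nonneg _)
  have h4 := mul_le_mul_of_nonneg_right (h2.trans h3) (apply_nonneg nrm (y - x))
  have h5 := (le_abs_self _).trans (h1.trans h4)
  simp only [sub_apply] at h5
  nlinarith

/-- The mean value theorem for `f · ζ - f · ζ'`. Moving `x` changes the comparison of `ζ` with `ζ'`
by a product of two distances, which is what makes near-minimizers stable. -/
theorem abs_sub_sub_sub_le (h : D.Assumptions nrm b L₁ lam₁ lam₂)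
    {ζ ζ' : EuclideanSpace ℝ (Fin m)} (hζ : ζ ∈ D.Gam) (hζ' : ζ' ∈ D.Gam) {x y : Fin d → ℝ}
    (hx : x ∈ D.X) (hy : y ∈ D.X) :
    |(D.f y ζ - D.f y ζ') - (D.f x ζ - D.f x ζ')| ≤ |lam₂| * ‖ζ - ζ'‖ * nrm (y - x) := by
  obtain ⟨z, hz, hzeq⟩ := domain_mvt (f := fun y => D.f y ζ - D.f y ζ')
    (f' := fun x => D.grad x ζ - D.grad x ζ')
    (fun w hw => ((h.hasFDerivAt hζ hw).sub (h.hasFDerivAt hζ' hw)).hasFDerivWithinAt)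
    h.X_convex hx hy
  have hzX : z ∈ D.X := h.X_convex.segment_subset hx hy hz
  rw [hzeq]
  refine (abs_apply_le_dualNorm_mul h.isNorm _ _).trans
    (mul_le_mul_of_nonneg_right ?_ (apply_nonneg _ _))
  exact (h.grad_lipschitz_right z hzX ζ hζ ζ' hζ').trans
    (mul_le_mul_of_nonneg_right (le_abs_self _) (norm_nonneg _))

theorem abs_grad_sub_le (h : D.Assumptions nrm b L₁ lam₁ lam₂)
    {ζ ζ' : EuclideanSpace ℝ (Fin m)} (hζ : ζ ∈ D.Gam) (hζ' : ζ' ∈ D.Gam) {x : Fin d → ℝ}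
    (hx : x ∈ D.X) (v : Fin d → ℝ) :
    |D.grad x ζ v - D.grad x ζ' v| ≤ |lam₂| * ‖ζ - ζ'‖ * nrm v := by
  have h1 := abs_apply_le_dualNorm_mul h.isNorm (D.grad x ζ - D.grad x ζ') v
  exact h1.trans (mul_le_mul_of_nonneg_right ((h.grad_lipschitz_right x hx ζ hζ ζ' hζ').trans
    (mul_le_mul_of_nonneg_right (le_abs_self _) (norm_nonneg _))) (apply_nonneg _ _))

end Problem.Assumptions

end WassersteinDRO

namespace WassersteinDRO

namespace Problem.Assumptions

variable {d m N : ℕ} {D : Problem d m N} {nrm : Seminorm ℝ (Fin d → ℝ)} {b : Fin d → ℝ}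
  {L₁ lam₁ lam₂ : ℝ}

/-! ### The regularized surrogate -/

theorem mem_Gam (h : D.Assumptions nrm b L₁ lam₁ lam₂) {ζ : Fin N → EuclideanSpace ℝ (Fin m)}
    (hζ : ζ ∈ D.Z) (i : Fin N) : ζ i ∈ D.Gam :=
  ⟨hζ.1 i, i, (Finset.single_le_sum (f := fun i => D.p i * ‖D.xi i - ζ i‖ ^ 2)
    (fun j _ => mul_nonneg (h.p_pos j).le (sq_nonneg _)) (Finset.mem_univ i)).trans hζ.2⟩

theorem xi_mem_Z (h : D.Assumptions nrm b L₁ lam₁ lam₂) : D.xi ∈ D.Z :=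
  ⟨h.xi_mem, by simpa using sq_nonneg D.θ⟩

theorem Xi_convex (h : D.Assumptions nrm b L₁ lam₁ lam₂) : Convex ℝ D.Xi :=
  (h.f_convex 0 h.zero_mem).1

theorem R_eq (D : Problem d m N) (ε : ℝ) (x : Fin d → ℝ) (ζ : Fin N → EuclideanSpace ℝ (Fin m)) :
    D.R ε x ζ = ∑ i, D.p i * D.f x (ζ i)
      + ε / (2 * D.θ ^ 2) * ∑ i, D.p i * ‖D.xi i - ζ i‖ ^ 2 := by
  rw [Problem.R, Finset.mul_sum, ← Finset.sum_add_distrib]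
  exact Finset.sum_congr rfl fun i _ => by ring

theorem sum_f_nonneg (h : D.Assumptions nrm b L₁ lam₁ lam₂) {x : Fin d → ℝ} (hx : x ∈ D.X)
    {ζ : Fin N → EuclideanSpace ℝ (Fin m)} (hζ : ζ ∈ D.Z) : 0 ≤ ∑ i, D.p i * D.f x (ζ i) :=
  Finset.sum_nonneg fun i _ => mul_nonneg (h.p_pos i).le (h.f_nonneg x hx _ (hζ.1 i))

theorem sum_f_le_R (h : D.Assumptions nrm b L₁ lam₁ lam₂) {ε : ℝ} (hε : 0 < ε)
    (x : Fin d → ℝ) (ζ : Fin N → EuclideanSpace ℝ (Fin m)) :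
    ∑ i, D.p i * D.f x (ζ i) ≤ D.R ε x ζ := by
  rw [R_eq]
  have : 0 ≤ ∑ i, D.p i * ‖D.xi i - ζ i‖ ^ 2 :=
    Finset.sum_nonneg fun i _ => mul_nonneg (h.p_pos i).le (sq_nonneg _)
  have := mul_nonneg (a := ε / (2 * D.θ ^ 2)) (by positivity) this
  linarith

theorem R_le_sum_f_add (h : D.Assumptions nrm b L₁ lam₁ lam₂) {ε : ℝ} (hε : 0 < ε)
    (x : Fin d → ℝ) {ζ : Fin N → EuclideanSpace ℝ (Fin m)} (hζ : ζ ∈ D.Z) :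
    D.R ε x ζ ≤ ∑ i, D.p i * D.f x (ζ i) + ε / 2 := by
  rw [R_eq]
  have h1 := mul_le_mul_of_nonneg_left hζ.2 (a := ε / (2 * D.θ ^ 2)) (by positivity)
  have h2 : ε / (2 * D.θ ^ 2) * D.θ ^ 2 = ε / 2 := by
    have := h.θ_pos.ne'
    field_simp
  linarith

theorem H_le (h : D.Assumptions nrm b L₁ lam₁ lam₂) {ε : ℝ} (hε : 0 < ε) {x : Fin d → ℝ}
    (hx : x ∈ D.X) {ζ : Fin N → EuclideanSpace ℝ (Fin m)} (hζ : ζ ∈ D.Z) :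
    D.H ε x ≤ D.R ε x ζ := by
  refine ciInf_le (f := fun ζ : D.Z => D.R ε x ζ) ⟨0, ?_⟩ ⟨ζ, hζ⟩
  rintro _ ⟨z, rfl⟩
  exact (h.sum_f_nonneg hx z.2).trans (h.sum_f_le_R hε x z)

theorem le_H (h : D.Assumptions nrm b L₁ lam₁ lam₂) {ε : ℝ} {x : Fin d → ℝ} {c : ℝ}
    (hc : ∀ ζ ∈ D.Z, c ≤ D.R ε x ζ) : c ≤ D.H ε x := by
  have : Nonempty D.Z := ⟨⟨_, h.xi_mem_Z⟩⟩
  exact le_ciInf fun ζ => hc ζ ζ.2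

theorem exists_R_lt (h : D.Assumptions nrm b L₁ lam₁ lam₂) (ε : ℝ) (x : Fin d → ℝ) {δ : ℝ}
    (hδ : 0 < δ) : ∃ ζ ∈ D.Z, D.R ε x ζ < D.H ε x + δ := by
  have : Nonempty D.Z := ⟨⟨_, h.xi_mem_Z⟩⟩
  obtain ⟨ζ, hζ⟩ := exists_lt_of_ciInf_lt (f := fun ζ : D.Z => D.R ε x ζ)
    (lt_add_of_pos_right (D.H ε x) hδ)
  exact ⟨ζ, ζ.2, hζ⟩

theorem norm_midpoint_sq {E : Type*} [NormedAddCommGroup E] [InnerProductSpace ℝ E] (c u w : E) :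
    ‖c - ((1 / 2 : ℝ) • u + (1 / 2 : ℝ) • w)‖ ^ 2
      = ‖c - u‖ ^ 2 / 2 + ‖c - w‖ ^ 2 / 2 - ‖u - w‖ ^ 2 / 4 := by
  have h1 := parallelogram_law_with_norm ℝ (c - u) (c - w)
  have h2 : c - ((1 / 2 : ℝ) • u + (1 / 2 : ℝ) • w) = (1 / 2 : ℝ) • ((c - u) + (c - w)) := by
    module
  have h3 : c - u - (c - w) = -(u - w) := by abel
  rw [h3, norm_neg] at h1
  rw [h2, norm_smul, mul_pow]
  norm_num
  linarith

/-- Strong convexity of `R ε x`: two near-minimizers over `Z` are close to each other. -/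
theorem sq_sum_norm_sub_le (h : D.Assumptions nrm b L₁ lam₁ lam₂) {ε : ℝ} (hε : 0 < ε)
    {x : Fin d → ℝ} (hx : x ∈ D.X) {ζ ζ' : Fin N → EuclideanSpace ℝ (Fin m)} (hζ : ζ ∈ D.Z)
    (hζ' : ζ' ∈ D.Z) :
    ε / (2 * D.θ ^ 2) / 2 * (∑ i, D.p i * ‖ζ i - ζ' i‖) ^ 2
      ≤ (D.R ε x ζ - D.H ε x) + (D.R ε x ζ' - D.H ε x) := by
  set k := ε / (2 * D.θ ^ 2) with hk
  have hkpos : 0 ≤ k := by positivity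
  -- The midpoint competes with `H`: it stays in `Z`, and strong convexity lowers its value by `k /
  -- 4` times the weighted squared distance.
  set μ : Fin N → EuclideanSpace ℝ (Fin m) := fun i => (1 / 2 : ℝ) • ζ i + (1 / 2 : ℝ) • ζ' i
    with hμ
  have hq : ∑ i, D.p i * ‖D.xi i - μ i‖ ^ 2 = (∑ i, D.p i * ‖D.xi i - ζ i‖ ^ 2) / 2
      + (∑ i, D.p i * ‖D.xi i - ζ' i‖ ^ 2) / 2 - (∑ i, D.p i * ‖ζ i - ζ' i‖ ^ 2) / 4 := by
    simp only [Finset.sum_div, ← Finset.sum_add_distrib, ← Finset.sum_sub_distrib]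
    refine Finset.sum_congr rfl fun i _ => ?_
    rw [hμ, norm_midpoint_sq]
    ring
  have hP : 0 ≤ ∑ i, D.p i * ‖ζ i - ζ' i‖ ^ 2 :=
    Finset.sum_nonneg fun i _ => mul_nonneg (h.p_pos i).le (sq_nonneg _)
  have hμZ : μ ∈ D.Z := by
    refine ⟨fun i => h.Xi_convex (hζ.1 i) (hζ'.1 i) (by norm_num) (by norm_num) (by norm_num), ?_⟩
    rw [hq]
    linarith [hζ.2, hζ'.2]
  have hf : ∑ i, D.p i * D.f x (μ i)
      ≤ (∑ i, D.p i * D.f x (ζ i)) / 2 + (∑ i, D.p i * D.f x (ζ' i)) / 2 := by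
    simp only [Finset.sum_div, ← Finset.sum_add_distrib]
    refine Finset.sum_le_sum fun i _ => ?_
    have hc := (h.f_convex x hx).2
    have := hc (hζ.1 i) (hζ'.1 i) (a := 1 / 2) (b := 1 / 2) (by norm_num) (by norm_num)
      (by norm_num)
    have := mul_le_mul_of_nonneg_left this (h.p_pos i).le
    simp only [smul_eq_mul] at this
    linarith
  have hsq : (∑ i, D.p i * ‖ζ i - ζ' i‖) ^ 2 ≤ ∑ i, D.p i * ‖ζ i - ζ' i‖ ^ 2 :=
    Real.pow_arith_mean_le_arith_mean_pow _ _ _ (fun i _ => (h.p_pos i).le) h.p_sum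
      (fun i _ => norm_nonneg _) 2
  have hH := h.H_le hε hx hμZ
  have h1 := mul_le_mul_of_nonneg_left hsq hkpos
  rw [R_eq] at hH ⊢
  rw [R_eq D ε x ζ']
  rw [hq] at hH
  rw [← hk] at hH ⊢
  nlinarith

/-- Near-minimizers of `R ε x` and `R ε y` are close when `x` and `y` are. -/
theorem sum_norm_sub_le (h : D.Assumptions nrm b L₁ lam₁ lam₂) {ε η r : ℝ} (hε : 0 < ε)
    (hr : 0 < r) {x y : Fin d → ℝ} (hx : x ∈ D.X) (hy : y ∈ D.X)
    {ζ ζ' : Fin N → EuclideanSpace ℝ (Fin m)} (hζ : ζ ∈ D.Z) (hζ' : ζ' ∈ D.Z)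
    (hgap : D.R ε x ζ - D.H ε x ≤ η) (hgap' : D.R ε y ζ' - D.H ε y ≤ η)
    (hη : 3 * η ≤ ε / (2 * D.θ ^ 2) * r ^ 2 / 4)
    (hxy : |lam₂| * nrm (y - x) ≤ ε / (2 * D.θ ^ 2) * r / 4) :
    ∑ i, D.p i * ‖ζ i - ζ' i‖ ≤ r := by
  have hsc := h.sq_sum_norm_sub_le hε hx hζ hζ'
  have hkpos : 0 < ε / (2 * D.θ ^ 2) := div_pos hε (by have := h.θ_pos; positivity)
  set k := ε / (2 * D.θ ^ 2) with hk
  set w := ∑ i, D.p i * ‖ζ i - ζ' i‖ with hw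
  have hw0 : 0 ≤ w := Finset.sum_nonneg fun i _ => mul_nonneg (h.p_pos i).le (norm_nonneg _)
  have hdd : D.R ε x ζ' - D.R ε x ζ - (D.R ε y ζ' - D.R ε y ζ) ≤ |lam₂| * nrm (y - x) * w := by
    simp only [R_eq]
    have : ∑ i, D.p i * ((D.f y (ζ i) - D.f y (ζ' i)) - (D.f x (ζ i) - D.f x (ζ' i)))
        ≤ ∑ i, |lam₂| * nrm (y - x) * (D.p i * ‖ζ i - ζ' i‖) := by
      refine Finset.sum_le_sum fun i _ => ?_
      have := mul_le_mul_of_nonneg_left ((le_abs_self _).trans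
        (h.abs_sub_sub_sub_le (h.mem_Gam hζ i) (h.mem_Gam hζ' i) hx hy)) (h.p_pos i).le
      linarith
    rw [← Finset.mul_sum, ← hw] at this
    simp only [mul_sub, Finset.sum_sub_distrib] at this
    linarith
  have hy' := h.H_le hε hy hζ
  -- Strong convexity at `x` and near-optimality at `y` give `k * w ^ 2 / 2 ≤ 3 * η + k * r * w /
  -- 4`. The right side is at most `k * r ^ 2 / 4 + k * r * w / 4`, impossible if `r < w`.
  by_contra! hlt
  have h1 := mul_le_mul_of_nonneg_right hxy hw0
  have h2 : k * r * w < k * w * w := by gcongr; exact hr.trans hlt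
  have h3 : k * r ^ 2 < k * w ^ 2 := by gcongr
  nlinarith

/-- Progress of one step of the continuous greedy algorithm. -/
theorem H_add_le_H_step (h : D.Assumptions nrm b L₁ lam₁ lam₂) {ε η r ρ τ G : ℝ} (hε : 0 < ε)
    (hr : 0 < r) (hη0 : 0 < η) (hτ : 0 ≤ τ) (hρ : 0 ≤ ρ) {x v z : Fin d → ℝ} (hx : x ∈ D.X)
    (hv : nrm v ≤ ρ) (hz : z ∈ D.X) (hy : x + τ • v ∈ D.X)
    {ζ : Fin N → EuclideanSpace ℝ (Fin m)} (hζ : ζ ∈ D.Z) (hgap : D.R ε x ζ - D.H ε x ≤ η)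
    (hmax : IsMaxOn (fun u => ∑ i, D.p i * D.grad x (ζ i) u) D.X v)
    (hG : ∀ ζ ∈ D.Z, G ≤ ∑ i, D.p i * D.f z (ζ i))
    (hη : 3 * η ≤ ε / (2 * D.θ ^ 2) * r ^ 2 / 4)
    (hτr : |lam₂| * (τ * ρ) ≤ ε / (2 * D.θ ^ 2) * r / 4) :
    D.H ε x + τ * (G - D.H ε x - (η + |lam₂| * r * ρ + |lam₁| * τ * ρ ^ 2))
      ≤ D.H ε (x + τ • v) := by
  set y := x + τ • v with hydef
  have hyx : y - x = τ • v := by rw [hydef, add_sub_cancel_left]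
  have hnyx : nrm (y - x) ≤ τ * ρ := by
    rw [hyx, map_smul_eq_mul, Real.norm_eq_abs, abs_of_nonneg hτ]
    exact mul_le_mul_of_nonneg_left hv hτ
  refine le_of_forall_pos_le_add fun δ hδ => ?_
  -- The slack `δ` is for the limit in the conclusion, `η` for the stability lemma; no exact
  -- minimizer is needed.
  obtain ⟨ζ', hζ', hlt⟩ := h.exists_R_lt ε y (lt_min hδ hη0)
  have hw : ∑ i, D.p i * ‖ζ i - ζ' i‖ ≤ r :=
    h.sum_norm_sub_le hε hr hx hy hζ hζ' hgap (by linarith [min_le_right δ η]) hη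
      ((mul_le_mul_of_nonneg_left hnyx (abs_nonneg _)).trans hτr)
  have h1 : τ * ∑ i, D.p i * D.grad x (ζ' i) v - |lam₁| * (τ * ρ) ^ 2
      ≤ ∑ i, D.p i * D.f y (ζ' i) - ∑ i, D.p i * D.f x (ζ' i) := by
    have e : |lam₁| * (τ * ρ) ^ 2 = ∑ i, D.p i * (|lam₁| * (τ * ρ) ^ 2) := by
      rw [← Finset.sum_mul, h.p_sum, one_mul]
    rw [e, Finset.mul_sum, ← Finset.sum_sub_distrib, ← Finset.sum_sub_distrib]
    refine Finset.sum_le_sum fun i _ => ?_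
    have := h.grad_sub_mul_sq_le (h.mem_Gam hζ' i) hx hy
    have h3 : |lam₁| * nrm (y - x) ^ 2 ≤ |lam₁| * (τ * ρ) ^ 2 := by
      gcongr
    rw [hyx, map_smul, smul_eq_mul, ← hyx] at this
    have := mul_le_mul_of_nonneg_left (this.trans' (sub_le_sub_left h3 _)) (h.p_pos i).le
    linarith
  -- The direction `v` was chosen for `ζ`, while the progress of `H` is measured at `ζ'`.
  have h2 : ∑ i, D.p i * D.grad x (ζ i) v - |lam₂| * r * ρ
      ≤ ∑ i, D.p i * D.grad x (ζ' i) v := by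
    have h3 : ∑ i, D.p i * (D.grad x (ζ i) v - D.grad x (ζ' i) v)
        ≤ ∑ i, |lam₂| * ρ * (D.p i * ‖ζ i - ζ' i‖) := by
      refine Finset.sum_le_sum fun i _ => ?_
      have h4 := (le_abs_self _).trans
        (h.abs_grad_sub_le (h.mem_Gam hζ i) (h.mem_Gam hζ' i) hx v)
      have h5 := mul_le_mul_of_nonneg_left hv
        (mul_nonneg (abs_nonneg lam₂) (norm_nonneg (ζ i - ζ' i)))
      have := mul_le_mul_of_nonneg_left (h4.trans h5) (h.p_pos i).le
      linarith
    rw [← Finset.mul_sum] at h3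
    have h4 := mul_le_mul_of_nonneg_left hw (mul_nonneg (abs_nonneg lam₂) hρ)
    simp only [mul_sub, Finset.sum_sub_distrib] at h3
    linarith
  have h3 : ∑ i, D.p i * D.f z (ζ i) - ∑ i, D.p i * D.f x (ζ i)
      ≤ ∑ i, D.p i * D.grad x (ζ i) z := by
    rw [← Finset.sum_sub_distrib]
    refine Finset.sum_le_sum fun i _ => ?_
    rw [← mul_sub]
    exact mul_le_mul_of_nonneg_left (sub_le_fderiv_apply (h.f_drSubmodular _ (hζ.1 i))
      (h.f_monotone _ (hζ.1 i)) (h.X_subset_box hx) (h.X_subset_box hz)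
      (h.hasFDerivAt (h.mem_Gam hζ i) hx)) (h.p_pos i).le
  have h4 : ∑ i, D.p i * D.grad x (ζ i) z ≤ ∑ i, D.p i * D.grad x (ζ i) v := hmax hz
  have h5 := h.sum_f_le_R hε x ζ
  have h6 := hG ζ hζ
  have h7 := h.H_le hε hx hζ'
  have h8 : G - D.H ε x - η - |lam₂| * r * ρ ≤ ∑ i, D.p i * D.grad x (ζ' i) v := by linarith
  have h9 := mul_le_mul_of_nonneg_left h8 hτ
  have h10 : D.R ε y ζ' - D.R ε x ζ' = ∑ i, D.p i * D.f y (ζ' i) - ∑ i, D.p i * D.f x (ζ' i) := by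
    rw [R_eq, R_eq]; ring
  have h11 := min_le_left δ η
  nlinarith

/-! ### Runs of the algorithm -/

/-- `x t` is `t / T` times an average of earlier directions, and `X` is convex and contains `0`. -/
theorem iterate_mem (h : D.Assumptions nrm b L₁ lam₁ lam₂) {ε Δ : ℝ} {T : ℕ} {x : ℕ → Fin d → ℝ}
    (hrun : D.IsRun ε Δ T x) {t : ℕ} (ht : t ≤ T) : x t ∈ D.X := by
  obtain ⟨hx0, ζ, v, hstep⟩ := hrun
  have key : ∀ t ≤ T, ∃ u ∈ D.X, x t = ((t : ℝ) / T) • u := by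
    intro t ht
    induction t with
    | zero => exact ⟨0, h.zero_mem, by simp [hx0]⟩
    | succ t ih =>
      obtain ⟨u, hu, hxu⟩ := ih (by omega)
      obtain ⟨-, ⟨hv, -⟩, hx⟩ := hstep t (by omega)
      have ht1 : (0 : ℝ) < (t : ℝ) + 1 := by positivity
      refine ⟨((t : ℝ) / (t + 1)) • u + (1 / ((t : ℝ) + 1)) • v t,
        h.X_convex hu hv (by positivity) (by positivity) (by field_simp), ?_⟩
      rw [hx, hxu, smul_add, smul_smul, smul_smul]
      push_cast
      congr 2 <;> field_simp
  obtain ⟨u, hu, hxu⟩ := key t ht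
  rw [hxu]
  refine h.X_convex.smul_mem_of_zero_mem h.zero_mem hu ⟨by positivity, ?_⟩
  exact div_le_one_of_le₀ (by exact_mod_cast ht) (by positivity)

/-- The value of the surrogate at the point returned by a run. -/
theorem mul_sub_le_H_run (h : D.Assumptions nrm b L₁ lam₁ lam₂) {ε η r ρ Δ G : ℝ} {T : ℕ}
    (hT : 0 < T) (hε : 0 < ε) (hr : 0 < r) (hη0 : 0 < η) (hΔ : Δ ≤ η)
    (hρ : ∀ x ∈ D.X, nrm x ≤ ρ) {x : ℕ → Fin d → ℝ} (hrun : D.IsRun ε Δ T x) {z : Fin d → ℝ}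
    (hz : z ∈ D.X) (hG0 : 0 ≤ G) (hG : ∀ ζ ∈ D.Z, G ≤ ∑ i, D.p i * D.f z (ζ i))
    (hη : 3 * η ≤ ε / (2 * D.θ ^ 2) * r ^ 2 / 4)
    (hτr : |lam₂| * (1 / (T : ℝ) * ρ) ≤ ε / (2 * D.θ ^ 2) * r / 4) :
    (1 - Real.exp (-1)) * G - (η + |lam₂| * r * ρ + |lam₁| * (1 / (T : ℝ)) * ρ ^ 2)
      ≤ D.H ε (x T) := by
  have hρ0 : 0 ≤ ρ := (apply_nonneg nrm 0).trans (hρ 0 h.zero_mem)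
  set E := η + |lam₂| * r * ρ + |lam₁| * (1 / (T : ℝ)) * ρ ^ 2 with hE
  have hE0 : 0 ≤ E := by positivity
  have hT1 : (1 : ℝ) / T ≤ 1 :=
    div_le_one_of_le₀ (by exact_mod_cast hT) (by positivity)
  -- Subtracting `E` from the gap turns the one-step bound into an exact contraction by `1 - 1 / T`.
  have key : ∀ t ≤ T, G - E - D.H ε (x t) ≤ (1 - 1 / (T : ℝ)) ^ t * G := by
    intro t ht
    induction t with
    | zero =>
      have : 0 ≤ D.H ε (x 0) := h.le_H fun ζ hζ =>
        (h.sum_f_nonneg (h.iterate_mem hrun ht) hζ).trans (h.sum_f_le_R hε _ ζ)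
      simp only [pow_zero, one_mul]
      linarith
    | succ t ih =>
      have ih := ih (by omega)
      have hxt := h.iterate_mem hrun (t := t) (by omega)
      have hxt1 := h.iterate_mem hrun ht
      obtain ⟨-, ζ, v, hstep⟩ := hrun
      obtain ⟨⟨hζ, hgap⟩, ⟨hv, hmax⟩, hx⟩ := hstep t (by omega)
      rw [hx] at hxt1
      have := h.H_add_le_H_step hε hr hη0 (by positivity) hρ0 hxt (hρ _ hv) hz hxt1 hζ
        (hgap.trans hΔ) hmax hG hη hτr
      rw [← hx, ← hE] at this
      have h1 := mul_le_mul_of_nonneg_left ih (sub_nonneg.2 hT1)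
      rw [pow_succ]
      linarith
  have h1 := key T le_rfl
  have h2 : (1 - 1 / (T : ℝ)) ^ T ≤ Real.exp (-1) :=
    Real.one_sub_div_pow_le_exp_neg (by exact_mod_cast hT)
  have h3 := mul_le_mul_of_nonneg_right h2 hG0
  linarith

end Problem.Assumptions

end WassersteinDRO

namespace WassersteinDRO

/-! ### Jensen's inequality up to an arbitrary error, for two convex functions simultaneously -/

/-- Some point of `S` does nearly as well as the mean, for two convex functions simultaneously. -/
theorem exists_mem_le_integral_add {Ω E : Type*} [MeasurableSpace Ω] [AddCommGroup E] [Module ℝ E]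
    {μ : Measure Ω} [IsProbabilityMeasure μ] {S : Set E} {g₁ g₂ : E → ℝ} (h₁ : ConvexOn ℝ S g₁)
    (h₂ : ConvexOn ℝ S g₂) {Y : Ω → E} (hY : ∀ᵐ ω ∂μ, Y ω ∈ S)
    (hi₁ : Integrable (fun ω => g₁ (Y ω)) μ) (hi₂ : Integrable (fun ω => g₂ (Y ω)) μ)
    {δ : ℝ} (hδ : 0 < δ) :
    ∃ ζ ∈ S, g₁ ζ ≤ ∫ ω, g₁ (Y ω) ∂μ + δ ∧ g₂ ζ ≤ ∫ ω, g₂ (Y ω) ∂μ + δ := by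
  -- The mean of the pair of values lies in the closure of this convex set; passing back from the
  -- closure costs `δ`. No barycentre of `Y` and no continuity of `g₁`, `g₂` is used.
  set A : Set (ℝ × ℝ) := {q | ∃ ζ ∈ S, g₁ ζ ≤ q.1 ∧ g₂ ζ ≤ q.2} with hA
  have hAc : Convex ℝ A := by
    rintro q ⟨ζ, hζ, hq1, hq2⟩ q' ⟨ζ', hζ', hq1', hq2'⟩ s t hs ht hst
    refine ⟨s • ζ + t • ζ', h₁.1 hζ hζ' hs ht hst, ?_, ?_⟩
    · refine (h₁.2 hζ hζ' hs ht hst).trans ?_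
      simp only [smul_eq_mul, Prod.fst_add, Prod.smul_fst]
      gcongr
    · refine (h₂.2 hζ hζ' hs ht hst).trans ?_
      simp only [smul_eq_mul, Prod.snd_add, Prod.smul_snd]
      gcongr
  have hmem : ∫ ω, (g₁ (Y ω), g₂ (Y ω)) ∂μ ∈ closure A :=
    hAc.closure.integral_mem isClosed_closure
      (hY.mono fun ω hω => subset_closure ⟨Y ω, hω, le_rfl, le_rfl⟩) (hi₁.prodMk hi₂)
  rw [integral_pair hi₁ hi₂] at hmem
  obtain ⟨q, ⟨ζ, hζ, hq1, hq2⟩, hdist⟩ := Metric.mem_closure_iff.1 hmem δ hδ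
  rw [Prod.dist_eq, max_lt_iff, Real.dist_eq, Real.dist_eq] at hdist
  refine ⟨ζ, hζ, ?_, ?_⟩
  · have := (abs_lt.1 hdist.1).1
    linarith
  · have := (abs_lt.1 hdist.2).1
    linarith

theorem exists_mem_le_lintegral_add {Ω E : Type*} [MeasurableSpace Ω] [AddCommGroup E]
    [Module ℝ E] {μ : Measure Ω} [IsProbabilityMeasure μ] {S : Set E} {g₁ g₂ : E → ℝ}
    (h₁ : ConvexOn ℝ S g₁) (h₂ : ConvexOn ℝ S g₂) (hn₁ : ∀ y ∈ S, 0 ≤ g₁ y)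
    (hn₂ : ∀ y ∈ S, 0 ≤ g₂ y) {Y : Ω → E} (hY : ∀ᵐ ω ∂μ, Y ω ∈ S)
    (hm₁ : AEMeasurable (fun ω => g₁ (Y ω)) μ) (hm₂ : AEMeasurable (fun ω => g₂ (Y ω)) μ)
    (hf₁ : ∫⁻ ω, ENNReal.ofReal (g₁ (Y ω)) ∂μ ≠ ∞) (hf₂ : ∫⁻ ω, ENNReal.ofReal (g₂ (Y ω)) ∂μ ≠ ∞)
    {δ : ℝ} (hδ : 0 < δ) :
    ∃ ζ ∈ S, g₁ ζ ≤ (∫⁻ ω, ENNReal.ofReal (g₁ (Y ω)) ∂μ).toReal + δ ∧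
      g₂ ζ ≤ (∫⁻ ω, ENNReal.ofReal (g₂ (Y ω)) ∂μ).toReal + δ := by
  have hp₁ : 0 ≤ᵐ[μ] fun ω => g₁ (Y ω) := hY.mono fun ω hω => hn₁ _ hω
  have hp₂ : 0 ≤ᵐ[μ] fun ω => g₂ (Y ω) := hY.mono fun ω hω => hn₂ _ hω
  rw [← integral_eq_lintegral_of_nonneg_ae hp₁ hm₁.aestronglyMeasurable,
    ← integral_eq_lintegral_of_nonneg_ae hp₂ hm₂.aestronglyMeasurable]
  exact exists_mem_le_integral_add h₁ h₂ hY
    ((lintegral_ofReal_ne_top_iff_integrable hm₁.aestronglyMeasurable hp₁).1 hf₁)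
    ((lintegral_ofReal_ne_top_iff_integrable hm₂.aestronglyMeasurable hp₂).1 hf₂) hδ

namespace Problem

variable {d m N : ℕ} {D : Problem d m N} {nrm : Seminorm ℝ (Fin d → ℝ)} {b : Fin d → ℝ}
  {L₁ lam₁ lam₂ : ℝ}

/-! ### Conditioning a coupling on the atoms of the reference distribution -/

open scoped Classical in
theorem Q_singleton (D : Problem d m N) (y : EuclideanSpace ℝ (Fin m)) :
    D.Q {y} = ∑ i with D.xi i = y, ENNReal.ofReal (D.p i) := by
  rw [Problem.Q, Measure.finsetSum_apply, Finset.sum_filter]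
  refine Finset.sum_congr rfl fun i _ => ?_
  by_cases hi : D.xi i = y <;> simp [hi]

/-- The event that the second marginal sits at the atom `y`. -/
def atomEvent (y : EuclideanSpace ℝ (Fin m)) :
    Set (EuclideanSpace ℝ (Fin m) × EuclideanSpace ℝ (Fin m)) := Prod.snd ⁻¹' {y}

theorem measurableSet_atomEvent (y : EuclideanSpace ℝ (Fin m)) : MeasurableSet (atomEvent y) :=
  measurable_snd (measurableSet_singleton y)

theorem measure_atomEvent
    {γ : Measure (EuclideanSpace ℝ (Fin m) × EuclideanSpace ℝ (Fin m))}
    (hγ : γ.map Prod.snd = D.Q) (y : EuclideanSpace ℝ (Fin m)) :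
    γ (atomEvent y) = D.Q {y} := by
  rw [← hγ, Measure.map_apply measurable_snd (measurableSet_singleton y)]
  rfl

/-- Atoms may coincide, so indices are grouped by the value of `xi`; on each fibre the weights add
up to the mass of the event and cancel its normalization. -/
theorem sum_lintegral_cond_le
    {γ : Measure (EuclideanSpace ℝ (Fin m) × EuclideanSpace ℝ (Fin m))}
    (hγ : γ.map Prod.snd = D.Q)
    (g : EuclideanSpace ℝ (Fin m) × EuclideanSpace ℝ (Fin m) → ℝ≥0∞) :
    ∑ i, ENNReal.ofReal (D.p i) * ∫⁻ z, g z ∂(ProbabilityTheory.cond γ (atomEvent (D.xi i)))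
      ≤ ∫⁻ z, g z ∂γ := by
  classical
  have e : ∀ y, ∫⁻ z, g z ∂(ProbabilityTheory.cond γ (atomEvent y))
      = (γ (atomEvent y))⁻¹ * ∫⁻ z in atomEvent y, g z ∂γ := fun y => by
    rw [ProbabilityTheory.cond, lintegral_smul_measure, smul_eq_mul]
  rw [← Finset.sum_fiberwise_of_maps_to (t := Finset.univ.image D.xi)
    (fun i hi => Finset.mem_image_of_mem D.xi hi)]
  have hdisj : ((Finset.univ.image D.xi : Finset (EuclideanSpace ℝ (Fin m))) :
      Set (EuclideanSpace ℝ (Fin m))).PairwiseDisjoint atomEvent := fun y _ y' _ hne =>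
    Disjoint.preimage _ (Set.disjoint_singleton.2 hne)
  calc _ ≤ ∑ y ∈ Finset.univ.image D.xi, ∫⁻ z in atomEvent y, g z ∂γ := by
        refine Finset.sum_le_sum fun y _ => ?_
        have : ∀ i ∈ ({i | D.xi i = y} : Finset (Fin N)), ENNReal.ofReal (D.p i) *
            ∫⁻ z, g z ∂(ProbabilityTheory.cond γ (atomEvent (D.xi i))) =
            ENNReal.ofReal (D.p i) * ((γ (atomEvent y))⁻¹ * ∫⁻ z in atomEvent y, g z ∂γ) := by
          intro i hi
          rw [(Finset.mem_filter.1 hi).2, e]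
        rw [Finset.sum_congr rfl this, ← Finset.sum_mul, ← Q_singleton, ← measure_atomEvent hγ,
          ← mul_assoc]
        exact mul_le_of_le_one_left' (ENNReal.mul_inv_le_one _)
    _ = ∫⁻ z in ⋃ y ∈ Finset.univ.image D.xi, atomEvent y, g z ∂γ :=
        (lintegral_biUnion_finset hdisj (fun y _ => measurableSet_atomEvent y) g).symm
    _ ≤ ∫⁻ z, g z ∂γ := setLIntegral_le_lintegral _ _

namespace Assumptions

/-! ### The worst-case expectation as a minimum over perturbed samples -/

theorem cond_facts (h : D.Assumptions nrm b L₁ lam₁ lam₂)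
    {γ : Measure (EuclideanSpace ℝ (Fin m) × EuclideanSpace ℝ (Fin m))} [IsProbabilityMeasure γ]
    (hγ : γ.map Prod.snd = D.Q) (i : Fin N) :
    IsProbabilityMeasure (ProbabilityTheory.cond γ (atomEvent (D.xi i))) ∧
      (∀ᵐ z ∂(ProbabilityTheory.cond γ (atomEvent (D.xi i))), z.2 = D.xi i) := by
  classical
  refine ⟨ProbabilityTheory.cond_isProbabilityMeasure ?_, ?_⟩
  · rw [measure_atomEvent hγ, Q_singleton]
    refine (lt_of_lt_of_le (ENNReal.ofReal_pos.2 (h.p_pos i)) ?_).ne'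
    exact Finset.single_le_sum (f := fun i => ENNReal.ofReal (D.p i)) (fun _ _ => zero_le)
      (Finset.mem_filter.2 ⟨Finset.mem_univ i, rfl⟩)
  · exact ProbabilityTheory.ae_cond_mem (measurableSet_atomEvent _)

/-- Given that the second coordinate is `xi i`, the law of the first is replaced by one point nearly
as good in both value and cost. The strict `θ < κ` absorbs both the near-optimal coupling and the
error in Jensen. -/
theorem exists_sum_le_of_coupling (h : D.Assumptions nrm b L₁ lam₁ lam₂) {x : Fin d → ℝ}
    (hx : x ∈ D.X) {P : Measure (EuclideanSpace ℝ (Fin m))} (hP : P ∈ D.ball)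
    (hfin : ∫⁻ ζ, ENNReal.ofReal (D.f x ζ) ∂P ≠ ∞) {κ δ : ℝ} (hκ : D.θ < κ) (hδ : 0 < δ) :
    ∃ ζ : Fin N → EuclideanSpace ℝ (Fin m), (∀ i, ζ i ∈ D.Xi) ∧
      ∑ i, D.p i * D.f x (ζ i) ≤ (∫⁻ ζ, ENNReal.ofReal (D.f x ζ) ∂P).toReal + δ ∧
      ∑ i, D.p i * ‖D.xi i - ζ i‖ ^ 2 ≤ κ ^ 2 := by
  obtain ⟨hprob, hXi, hW⟩ := hP
  have hκ0 : 0 < κ := h.θ_pos.trans hκ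
  have hW' := hW.trans_lt ((ENNReal.ofReal_lt_ofReal_iff hκ0).2 hκ)
  simp only [wassersteinDist, iInf_lt_iff] at hW'
  obtain ⟨γ, ⟨hγ1, hγ2⟩, hcost⟩ := hW'
  have hγprob : IsProbabilityMeasure γ := ⟨by
    have : γ.map Prod.fst Set.univ = 1 := by rw [hγ1]; exact measure_univ
    rwa [Measure.map_apply measurable_fst MeasurableSet.univ, Set.preimage_univ] at this⟩
  set K := ∫⁻ z, ‖z.1 - z.2‖ₑ ^ 2 ∂γ with hK
  have hKlt : K < ENNReal.ofReal (κ ^ 2) := by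
    rw [ENNReal.ofReal_pow hκ0.le]
    have := (ENNReal.rpow_lt_rpow_iff (z := 2) (by norm_num)).2 hcost
    rwa [← ENNReal.rpow_mul, ENNReal.rpow_two, div_mul_cancel₀ _ two_ne_zero,
      ENNReal.rpow_one] at this
  have hKfin : K ≠ ∞ := hKlt.ne_top
  have hKreal : K.toReal < κ ^ 2 := (ENNReal.lt_ofReal_iff_toReal_lt hKfin).1 hKlt
  set I := ∫⁻ ζ, ENNReal.ofReal (D.f x ζ) ∂P with hI
  have hPae : ∀ᵐ ζ ∂P, ζ ∈ D.Xi := hXi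
  have hfm : AEMeasurable (D.f x) P := by
    rw [← Measure.restrict_eq_self_of_ae_mem hPae]
    exact aemeasurable_restrict_of_measurable_subtype h.Xi_measurable (h.f_measurable x hx)
  have hfm' : AEMeasurable (fun z : EuclideanSpace ℝ (Fin m) × EuclideanSpace ℝ (Fin m) =>
      D.f x z.1) γ := by
    rw [← hγ1] at hfm
    exact hfm.comp_measurable measurable_fst
  have hγae : ∀ᵐ z ∂γ, z.1 ∈ D.Xi := by
    rw [← hγ1] at hPae
    exact ae_of_ae_map measurable_fst.aemeasurable hPae
  have hIγ : ∫⁻ z, ENNReal.ofReal (D.f x z.1) ∂γ = I := by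
    rw [hI, ← hγ1]
    rw [← hγ1] at hfm
    exact (lintegral_map' hfm.ennreal_ofReal measurable_fst.aemeasurable).symm
  set a : Fin N → ℝ≥0∞ := fun i =>
    ∫⁻ z, ENNReal.ofReal (D.f x z.1) ∂(ProbabilityTheory.cond γ (atomEvent (D.xi i))) with ha
  set c : Fin N → ℝ≥0∞ := fun i =>
    ∫⁻ z, ENNReal.ofReal (‖D.xi i - z.1‖ ^ 2)
      ∂(ProbabilityTheory.cond γ (atomEvent (D.xi i))) with hc
  have hca : ∀ i, c i
      = ∫⁻ z, ‖z.1 - z.2‖ₑ ^ 2 ∂(ProbabilityTheory.cond γ (atomEvent (D.xi i))) := fun i => by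
    refine lintegral_congr_ae ((h.cond_facts hγ2 i).2.mono fun z hz => ?_)
    simp only [hz]
    rw [ENNReal.ofReal_pow (norm_nonneg _), ofReal_norm, ← enorm_neg, neg_sub]
  have hasum : ∑ i, ENNReal.ofReal (D.p i) * a i ≤ I := hIγ ▸ sum_lintegral_cond_le hγ2 _
  have hcsum : ∑ i, ENNReal.ofReal (D.p i) * c i ≤ K := by
    simp only [hca]
    exact sum_lintegral_cond_le hγ2 _
  have hsum : ∀ (u : Fin N → ℝ≥0∞) (J : ℝ≥0∞), J ≠ ∞ →
      ∑ i, ENNReal.ofReal (D.p i) * u i ≤ J →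
      (∀ i, u i ≠ ∞) ∧ ∑ i, D.p i * (u i).toReal ≤ J.toReal := by
    intro u J hJ hle
    have hterm : ∀ i, ENNReal.ofReal (D.p i) * u i ≠ ∞ := fun i =>
      ((Finset.single_le_sum (f := fun i => ENNReal.ofReal (D.p i) * u i) (fun _ _ => zero_le)
        (Finset.mem_univ i)).trans hle).trans_lt hJ.lt_top |>.ne
    refine ⟨fun i hi => hterm i ?_, ?_⟩
    · rw [hi, ENNReal.mul_top (ENNReal.ofReal_pos.2 (h.p_pos i)).ne']
    · have := ENNReal.toReal_mono hJ hle
      rw [ENNReal.toReal_sum fun i _ => hterm i] at this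
      simpa [ENNReal.toReal_mul, ENNReal.toReal_ofReal (h.p_pos _).le] using this
  obtain ⟨hafin, hareal⟩ := hsum a I hfin hasum
  obtain ⟨hcfin, hcreal⟩ := hsum c K hKfin hcsum
  set δ' := min δ (κ ^ 2 - K.toReal) with hδ'
  have hδ'0 : 0 < δ' := lt_min hδ (sub_pos.2 hKreal)
  have hpoint : ∀ i, ∃ ζ ∈ D.Xi, D.f x ζ ≤ (a i).toReal + δ' ∧
      ‖D.xi i - ζ‖ ^ 2 ≤ (c i).toReal + δ' := by
    intro i
    obtain ⟨hpi, -⟩ := h.cond_facts hγ2 i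
    have habs : ProbabilityTheory.cond γ (atomEvent (D.xi i)) ≪ γ :=
      ProbabilityTheory.cond_absolutelyContinuous
    have hconv : ConvexOn ℝ D.Xi fun ζ => ‖D.xi i - ζ‖ ^ 2 := by
      refine ConvexOn.pow ?_ (fun _ _ => norm_nonneg _) 2
      have := convexOn_dist (D.xi i) h.Xi_convex
      refine this.congr fun ζ _ => ?_
      exact (dist_comm _ _).trans (dist_eq_norm _ _)
    exact exists_mem_le_lintegral_add (h.f_convex x hx) hconv (h.f_nonneg x hx)
      (fun _ _ => sq_nonneg _) (Y := Prod.fst) (habs.ae_le hγae) (hfm'.mono_ac habs)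
      (by fun_prop) (hafin i) (hcfin i) hδ'0
  choose ζ hζ hζf hζc using hpoint
  have hadd : ∀ (u v : Fin N → ℝ), (∀ i, u i ≤ v i + δ') →
      ∑ i, D.p i * u i ≤ ∑ i, D.p i * v i + δ' := fun u v huv => by
    calc _ ≤ ∑ i, D.p i * (v i + δ') :=
          Finset.sum_le_sum fun i _ => mul_le_mul_of_nonneg_left (huv i) (h.p_pos i).le
      _ = _ := by simp only [mul_add, Finset.sum_add_distrib, ← Finset.sum_mul, h.p_sum, one_mul]
  refine ⟨ζ, hζ, ?_, ?_⟩
  · have := hadd _ _ hζf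
    linarith [min_le_left δ (κ ^ 2 - K.toReal)]
  · have := hadd _ _ hζc
    linarith [min_le_right δ (κ ^ 2 - K.toReal)]

/-- A lower bound for the sample problem over `Z` is a lower bound for the worst-case
expectation. -/
theorem ofReal_le_F (h : D.Assumptions nrm b L₁ lam₁ lam₂) {x : Fin d → ℝ} (hx : x ∈ D.X) {c : ℝ}
    (hc : ∀ ζ ∈ D.Z, c ≤ ∑ i, D.p i * D.f x (ζ i)) : ENNReal.ofReal c ≤ D.F x := by
  refine le_iInf₂ fun P hP => ?_
  by_cases hfin : ∫⁻ ζ, ENNReal.ofReal (D.f x ζ) ∂P = ∞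
  · rw [hfin]; exact le_top
  refine ENNReal.ofReal_le_of_le_toReal (le_of_forall_pos_le_add fun δ hδ => ?_)
  have hθ := h.θ_pos
  set M := ∑ i, D.p i * D.f x (D.xi i) with hM
  have hM0 : 0 ≤ M := h.sum_f_nonneg hx h.xi_mem_Z
  set I := (∫⁻ ζ, ENNReal.ofReal (D.f x ζ) ∂P).toReal with hI
  have hI0 : 0 ≤ I := ENNReal.toReal_nonneg
  -- Shrinking towards `xi` by `s` brings radius `θ / s` back to `θ`; this `s` makes the cost `(1 -
  -- s) * M` at most `δ / 2`.
  set s : ℝ := (M + 1) / (M + 1 + δ / 2) with hs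
  have hs0 : 0 < s := by positivity
  have hs1 : s < 1 := by rw [hs, div_lt_one (by positivity)]; linarith
  have hsM : (1 - s) * M ≤ δ / 2 := by
    have : 1 - s = δ / 2 / (M + 1 + δ / 2) := by rw [hs]; field_simp; ring
    rw [this, div_mul_eq_mul_div, div_le_iff₀ (by positivity)]
    nlinarith
  have hκ : D.θ < D.θ / s := by rw [lt_div_iff₀ hs0]; nlinarith
  obtain ⟨ζ, hζ, hζf, hζc⟩ := h.exists_sum_le_of_coupling hx hP hfin hκ (half_pos hδ)
  have hmem : (fun i => s • ζ i + (1 - s) • D.xi i) ∈ D.Z := by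
    refine ⟨fun i => h.Xi_convex (hζ i) (h.xi_mem i) hs0.le (by linarith) (by ring), ?_⟩
    have e : ∀ i, D.p i * ‖D.xi i - (s • ζ i + (1 - s) • D.xi i)‖ ^ 2
        = s ^ 2 * (D.p i * ‖D.xi i - ζ i‖ ^ 2) := fun i => by
      rw [show D.xi i - (s • ζ i + (1 - s) • D.xi i) = s • (D.xi i - ζ i) by module, norm_smul,
        Real.norm_eq_abs, mul_pow, sq_abs]
      ring
    simp only [e, ← Finset.mul_sum]
    calc s ^ 2 * ∑ i, D.p i * ‖D.xi i - ζ i‖ ^ 2 ≤ s ^ 2 * (D.θ / s) ^ 2 := by gcongr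
      _ = D.θ ^ 2 := by field_simp
  have hconv : ∑ i, D.p i * D.f x (s • ζ i + (1 - s) • D.xi i)
      ≤ s * ∑ i, D.p i * D.f x (ζ i) + (1 - s) * M := by
    rw [hM, Finset.mul_sum, Finset.mul_sum, ← Finset.sum_add_distrib]
    refine Finset.sum_le_sum fun i _ => ?_
    have := mul_le_mul_of_nonneg_left ((h.f_convex x hx).2 (hζ i) (h.xi_mem i) hs0.le
      (sub_nonneg.2 hs1.le) (by ring)) (h.p_pos i).le
    simp only [smul_eq_mul] at this
    linarith
  have h1 := hc _ hmem
  have h2 : s * ∑ i, D.p i * D.f x (ζ i) ≤ I + δ / 2 :=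
    (mul_le_mul_of_nonneg_left hζf hs0.le).trans
      (mul_le_of_le_one_left (by positivity) hs1.le)
  linarith

/-- Every admissible perturbed sample vector bounds the worst-case expectation from above. -/
theorem F_le_ofReal (h : D.Assumptions nrm b L₁ lam₁ lam₂) {x : Fin d → ℝ} (hx : x ∈ D.X)
    {ζ : Fin N → EuclideanSpace ℝ (Fin m)} (hζ : ζ ∈ D.Z) :
    D.F x ≤ ENNReal.ofReal (∑ i, D.p i * D.f x (ζ i)) := by
  set γ : Measure (EuclideanSpace ℝ (Fin m) × EuclideanSpace ℝ (Fin m)) :=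
    ∑ i, ENNReal.ofReal (D.p i) • Measure.dirac (ζ i, D.xi i) with hγ
  set P : Measure (EuclideanSpace ℝ (Fin m)) :=
    ∑ i, ENNReal.ofReal (D.p i) • Measure.dirac (ζ i) with hP
  have hpsum : ∑ i, ENNReal.ofReal (D.p i) = 1 := by
    rw [← ENNReal.ofReal_sum_of_nonneg fun i _ => (h.p_pos i).le, h.p_sum, ENNReal.ofReal_one]
  have hcpl : IsCoupling γ P D.Q := by
    constructor
    · ext s hs
      rw [Measure.map_apply measurable_fst hs, hγ, hP]
      simp [Measure.finsetSum_apply, hs, measurable_fst hs]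
      rfl
    · ext s hs
      rw [Measure.map_apply measurable_snd hs, hγ, Problem.Q]
      simp [Measure.finsetSum_apply, hs, measurable_snd hs]
      rfl
  have hint : ∀ g : EuclideanSpace ℝ (Fin m) → ℝ, (∀ i, 0 ≤ g (ζ i)) →
      ∫⁻ z, ENNReal.ofReal (g z) ∂P = ENNReal.ofReal (∑ i, D.p i * g (ζ i)) := fun g hg => by
    rw [hP, lintegral_finsetSum_measure,
      ENNReal.ofReal_sum_of_nonneg fun i _ => mul_nonneg (h.p_pos i).le (hg i)]
    refine Finset.sum_congr rfl fun i _ => ?_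
    rw [lintegral_smul_measure, lintegral_dirac, smul_eq_mul, ENNReal.ofReal_mul (h.p_pos i).le]
  have hcost : ∫⁻ z, ‖z.1 - z.2‖ₑ ^ 2 ∂γ
      = ENNReal.ofReal (∑ i, D.p i * ‖D.xi i - ζ i‖ ^ 2) := by
    rw [hγ, lintegral_finsetSum_measure,
      ENNReal.ofReal_sum_of_nonneg fun i _ => mul_nonneg (h.p_pos i).le (sq_nonneg _)]
    refine Finset.sum_congr rfl fun i _ => ?_
    rw [lintegral_smul_measure, lintegral_dirac, smul_eq_mul, ENNReal.ofReal_mul (h.p_pos i).le,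
      ENNReal.ofReal_pow (norm_nonneg _), ofReal_norm, ← enorm_neg, neg_sub]
  have hball : P ∈ D.ball := by
    refine ⟨⟨?_⟩, ?_, ?_⟩
    · simp [hP, Measure.finsetSum_apply, hpsum]
    · simp [hP, Measure.finsetSum_apply, h.Xi_measurable.compl, hζ.1]
    · refine iInf₂_le_of_le γ hcpl ?_
      rw [hcost]
      calc _ ≤ ENNReal.ofReal (D.θ ^ 2) ^ (1 / 2 : ℝ) := by
            gcongr
            exact hζ.2
        _ = ENNReal.ofReal D.θ := by
            rw [ENNReal.ofReal_rpow_of_nonneg (sq_nonneg _) (by norm_num), ← Real.sqrt_eq_rpow,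
              Real.sqrt_sq h.θ_pos.le]
  refine (iInf₂_le P hball).trans ?_
  rw [hint _ fun i => h.f_nonneg x hx _ (hζ.1 i)]

end Assumptions

end Problem

end WassersteinDRO

namespace WassersteinDRO.Problem.Assumptions

variable {d m N : ℕ} {D : Problem d m N} {nrm : Seminorm ℝ (Fin d → ℝ)} {b : Fin d → ℝ}
  {L₁ lam₁ lam₂ : ℝ}

/-! ### The approximation guarantee -/

/-- This settles large `ε`: feasible values differ by at most `2 * |L₁| * ρ`. -/
theorem sum_f_sub_le (h : D.Assumptions nrm b L₁ lam₁ lam₂) {ρ : ℝ} (hρ : ∀ x ∈ D.X, nrm x ≤ ρ)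
    {x z : Fin d → ℝ} (hx : x ∈ D.X) (hz : z ∈ D.X) {ζ : Fin N → EuclideanSpace ℝ (Fin m)}
    (hζ : ζ ∈ D.Z) :
    ∑ i, D.p i * D.f z (ζ i) - 2 * |L₁| * ρ ≤ ∑ i, D.p i * D.f x (ζ i) := by
  have hnrm : nrm (z - x) ≤ 2 * ρ :=
    (map_sub_le_add nrm z x).trans (by linarith [hρ x hx, hρ z hz])
  have : ∑ i, D.p i * (D.f z (ζ i) - D.f x (ζ i)) ≤ ∑ i, D.p i * (|L₁| * (2 * ρ)) :=
    Finset.sum_le_sum fun i _ => mul_le_mul_of_nonneg_left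
      ((le_abs_self _).trans ((h.f_lipschitz _ (h.mem_Gam hζ i) z hz x hx).trans
        (mul_le_mul (le_abs_self _) hnrm (apply_nonneg _ _) (abs_nonneg _)))) (h.p_pos i).le
  rw [← Finset.sum_mul, h.p_sum] at this
  simp only [mul_sub, Finset.sum_sub_distrib] at this
  linarith

/-- To establish an approximation guarantee, it suffices to compare sample problems over `Z`. -/
theorem isApproxSolution_of_forall (h : D.Assumptions nrm b L₁ lam₁ lam₂) {α ε : ℝ} (hα : 0 ≤ α)
    {x : Fin d → ℝ} (hx : x ∈ D.X)
    (H : ∀ z ∈ D.X, ∀ G : ℝ, 0 ≤ G → (∀ ζ ∈ D.Z, G ≤ ∑ i, D.p i * D.f z (ζ i)) →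
      ∀ ζ ∈ D.Z, α * G - ε ≤ ∑ i, D.p i * D.f x (ζ i)) :
    D.IsApproxSolution α ε x := by
  refine ⟨hx, ?_⟩
  rw [Problem.opt]
  simp only [ENNReal.mul_iSup]
  refine iSup₂_le fun z hz => ?_
  have hfin : D.F z ≠ ∞ := ((h.F_le_ofReal hz h.xi_mem_Z).trans_lt ENNReal.ofReal_lt_top).ne
  have hG : ∀ ζ ∈ D.Z, (D.F z).toReal ≤ ∑ i, D.p i * D.f z (ζ i) := fun ζ hζ =>
    ENNReal.toReal_le_of_le_ofReal (h.sum_f_nonneg hz hζ) (h.F_le_ofReal hz hζ)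
  have := h.ofReal_le_F hx (H z hz _ ENNReal.toReal_nonneg hG)
  calc ENNReal.ofReal α * D.F z
      = ENNReal.ofReal (α * (D.F z).toReal - ε + ε) := by
        rw [sub_add_cancel, ENNReal.ofReal_mul hα, ENNReal.ofReal_toReal hfin]
    _ ≤ ENNReal.ofReal (α * (D.F z).toReal - ε) + ENNReal.ofReal ε := ENNReal.ofReal_add_le
    _ ≤ D.F x + ENNReal.ofReal ε := by gcongr

end WassersteinDRO.Problem.Assumptions

theorem mainTheorem1 (L₁ lam₁ lam₂ θ ρ : ℝ) :
    ∃ c C : ℝ, 0 < c ∧ 0 < C ∧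
      ∀ (d m N : ℕ) (D : WassersteinDRO.Problem d m N)
        (nrm : Seminorm ℝ (Fin d → ℝ)) (b : Fin d → ℝ),
        D.Assumptions nrm b L₁ lam₁ lam₂ → D.θ = θ → (∀ x ∈ D.X, nrm x ≤ ρ) →
        ∀ (ε Δ : ℝ) (T : ℕ), 0 < ε → Δ ≤ c * ε ^ 3 → C / ε ^ 2 ≤ (T : ℝ) →
          ∀ x : ℕ → Fin d → ℝ, D.IsRun ε Δ T x →
            D.IsApproxSolution (1 - Real.exp (-1)) ε (x T) := by
  obtain ⟨e₀, he₀⟩ : ∃ e₀ : ℝ, e₀ = 2 * |L₁| * |ρ| + 1 := ⟨_, rfl⟩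
  obtain ⟨B, hB⟩ : ∃ B : ℝ, B = |lam₂| * |ρ| + 1 := ⟨_, rfl⟩
  have he₀pos : 0 < e₀ := by rw [he₀]; positivity
  have hBpos : 0 < B := by rw [hB]; positivity
  -- With `r = ε / (8 * B)`, the first summands in `c` and `C` give the two stability conditions.
  -- The second ones make the errors from `Δ` and `lam₁` at most `ε / 8` once `ε ≤ e₀`. The added
  -- `1`s ensure positivity.
  obtain ⟨c, hc⟩ : ∃ c : ℝ, c = 1 / (1536 * (θ ^ 2 + 1) * B ^ 2 + 8 * e₀ ^ 2) := ⟨_, rfl⟩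
  obtain ⟨C, hC⟩ : ∃ C : ℝ, C = 64 * (θ ^ 2 + 1) * B ^ 2 + 8 * |lam₁| * ρ ^ 2 * e₀ := ⟨_, rfl⟩
  have hcpos : 0 < c := by rw [hc]; positivity
  have hCpos : 0 < C := by rw [hC]; positivity
  refine ⟨c, C, hcpos, hCpos, ?_⟩
  intro d m N D nrm b h hθ hρ ε Δ T hε hΔ hT x hrun
  have hexp0 := Real.exp_pos (-1)
  have hexp1 : Real.exp (-1) ≤ 1 := Real.exp_le_one_iff.2 (by norm_num)
  have hxT := h.iterate_mem hrun le_rfl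
  have hρ0 : 0 ≤ ρ := (apply_nonneg nrm 0).trans (hρ 0 h.zero_mem)
  rw [abs_of_nonneg hρ0] at he₀ hB
  refine h.isApproxSolution_of_forall (by linarith) hxT fun z hz G hG0 hG ζ hζ => ?_
  rcases le_total e₀ ε with hbig | hsmall
  · have h1 := h.sum_f_sub_le hρ hxT hz hζ
    have h2 := hG ζ hζ
    have h3 := mul_nonneg hexp0.le hG0
    linarith
  have hθpos : 0 < θ := hθ ▸ h.θ_pos
  have hTpos : (0 : ℝ) < T := (div_pos hCpos (by positivity)).trans_le hT
  have hTinv : 1 / (T : ℝ) ≤ ε ^ 2 / C := by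
    rw [div_le_div_iff₀ hTpos hCpos]
    rw [div_le_iff₀ (by positivity)] at hT
    linarith
  have hlam₂ : |lam₂| * ρ ≤ B := by rw [hB]; linarith
  have hε2 : ε ^ 2 ≤ e₀ ^ 2 := by gcongr
  have hcB : c * (1536 * θ ^ 2 * B ^ 2) ≤ 1 := by
    rw [hc, one_div_mul_eq_div, div_le_one (by positivity)]
    nlinarith [sq_nonneg B, sq_nonneg e₀]
  have hce : c * (8 * e₀ ^ 2) ≤ 1 := by
    rw [hc, one_div_mul_eq_div, div_le_one (by positivity)]
    have : 0 ≤ 1536 * (θ ^ 2 + 1) * B ^ 2 := by positivity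
    linarith
  have hCB : 64 * θ ^ 2 * B ^ 2 ≤ C := by
    have : 0 ≤ 64 * B ^ 2 + 8 * |lam₁| * ρ ^ 2 * e₀ := by positivity
    rw [hC]; linarith
  have hCe : 8 * |lam₁| * ρ ^ 2 * e₀ ≤ C := by
    have : 0 ≤ 64 * (θ ^ 2 + 1) * B ^ 2 := by positivity
    rw [hC]; linarith
  have key := h.mul_sub_le_H_run (η := c * ε ^ 3) (r := ε / (8 * B)) (Nat.cast_pos.1 hTpos) hε
    (by positivity) (by positivity) hΔ hρ hrun hz hG0 hG
    (by
      rw [hθ]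
      have e : ε / (2 * θ ^ 2) * (ε / (8 * B)) ^ 2 / 4
          = 3 * (ε ^ 3 / (1536 * θ ^ 2 * B ^ 2)) := by field_simp; norm_num
      rw [e]
      gcongr
      rw [le_div_iff₀ (by positivity)]
      calc c * ε ^ 3 * (1536 * θ ^ 2 * B ^ 2) = c * (1536 * θ ^ 2 * B ^ 2) * ε ^ 3 := by ring
        _ ≤ 1 * ε ^ 3 := by gcongr
        _ = ε ^ 3 := one_mul _)
    (by
      rw [hθ]
      calc |lam₂| * (1 / (T : ℝ) * ρ) = |lam₂| * ρ * (1 / (T : ℝ)) := by ring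
        _ ≤ B * (ε ^ 2 / C) := by gcongr
        _ ≤ B * (ε ^ 2 / (64 * θ ^ 2 * B ^ 2)) := by gcongr
        _ = ε / (2 * θ ^ 2) * (ε / (8 * B)) / 4 := by field_simp; norm_num)
  -- Three errors of `ε / 8` and the regularization bias `ε / 2` total less than `ε`.
  have hE1 : c * ε ^ 3 ≤ ε / 8 := by
    have : c * (8 * ε ^ 2) ≤ 1 := (by gcongr : c * (8 * ε ^ 2) ≤ c * (8 * e₀ ^ 2)).trans hce
    nlinarith
  have hE2 : |lam₂| * (ε / (8 * B)) * ρ ≤ ε / 8 := by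
    calc |lam₂| * (ε / (8 * B)) * ρ = |lam₂| * ρ * (ε / (8 * B)) := by ring
      _ ≤ B * (ε / (8 * B)) := by gcongr
      _ = ε / 8 := by field_simp
  have hE3 : |lam₁| * (1 / (T : ℝ)) * ρ ^ 2 ≤ ε / 8 := by
    calc |lam₁| * (1 / (T : ℝ)) * ρ ^ 2 ≤ |lam₁| * (ε ^ 2 / C) * ρ ^ 2 := by gcongr
      _ = 8 * |lam₁| * ρ ^ 2 * ε * ε / (8 * C) := by field_simp
      _ ≤ 8 * |lam₁| * ρ ^ 2 * e₀ * ε / (8 * C) := by gcongr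
      _ ≤ C * ε / (8 * C) := by gcongr
      _ = ε / 8 := by field_simp
  have h1 := h.H_le hε hxT hζ
  have h2 := h.R_le_sum_f_add hε (x T) hζ
  linarith
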